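/- Let $k\ge 2$, let $\mathcal S_k$ be the symmetric group on $\{1,\dots,k\}$, and write $(ij)$ for a transposition. (a) Let $\gamma_1=\dots=\gamma_{k-1}$ be equal nonnegative real numbers. Then for every function $g:\mathcal S_k\to\mathbb R$, $$\sum_{\sigma\in\mathcal S_k}\sum_{i=1}^{k-1}\gamma_i\,[g(\sigma)-g((ik)\sigma)]^2\;\ge\;\sum_{\sigma\in\mathcal S_k}\sum_{1\le i<j\le k-1}\frac{\gamma_i\gamma_j}{\gamma_1+\dots+\gamma_{k-1}}\,[g(\sigma)-g((ij)\sigma)]^2,$$ where an empty sum is zero and the right-hand side is read as $0$ if all $\gamma_i$ vanish. (b) Let $\lambda$ be a partition of $k$. For a standard Young tableau $t$ of shape $\lambda$ let $c^t_i$ be the content (column minus row) of the box of $t$ containing $i$. Let $\rho^\lambda_{ij}$ be the matrix of $(ij)$ in Young's orthonormal representation, whose rows and columns are indexed by the standard Young tableaux of shape $\lambda$: $\rho^\lambda_{i,i+1}(t,t)$ is $1$, $-1$ or $1/r$ according to whether $i,i+1$ are in the same row of $t$, in the same column of $t$, or neither, where $r=c^t_{i+1}-c^t_i$; in the last case $\rho^\lambda_{i,i+1}(t,s)=\sqrt{1-r^{-2}}$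 for the tableau $s$ obtained from $t$ by exchanging $i$ and $i+1$; all other entries of $\rho^\lambda_{i,i+1}$ are zero; and $\rho^\lambda_{i,j+1}=\rho^\lambda_{j,j+1}\,\rho^\lambda_{ij}\,\rho^\lambda_{j,j+1}$ for $i<j$. Put $V^\lambda_{ij}=I-\rho^\lambda_{ij}$ and let $X^\lambda_j=\sum_{i<j}\rho^\lambda_{ij}$ be the Jucys–Murphy matrices (so $X^\lambda_1=0$). Then $$(k-1)\sum_{i=1}^{k-1}V^\lambda_{ik}-\sum_{1\le i<j\le k-1}V^\lambda_{ij}\;=\;\tfrac12k(k-1)\,I+\sum_{i=1}^kX^\lambda_i-k\,X^\lambda_k .$$ This matrix is diagonal, its entry at $(t,t)$ is $\tfrac12k(k-1)+\sum_{i=1}^kc^t_i-k\,c^t_k$, every one of these entries is nonnegative, and the matrix is therefore positive semidefinite. -/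

import Mathlib

namespace YoungForm

/-- A standard Young tableau with shape `μ` and entries `0, …, k - 1` (in place of `1, …, k`):
`box i` is the box that contains the entry `i`, boxes being pairs (row, column), and the entries
increase along every row and along every column. -/
@[ext]
structure StandardTableau (k : ℕ) (μ : YoungDiagram) where
  box : Fin k ≃ μ.cells
  row_increasing : ∀ i j : Fin k, (box i).1.1 = (box j).1.1 → (box i).1.2 < (box j).1.2 → i < j
  col_increasing : ∀ i j : Fin k, (box i).1.2 = (box j).1.2 → (box i).1.1 < (box j).1.1 → i < j

variable {k : ℕ} {μ : YoungDiagram}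

noncomputable instance : Fintype (StandardTableau k μ) :=
  haveI : Finite (StandardTableau k μ) :=
    Finite.of_injective StandardTableau.box fun _ _ h => StandardTableau.ext h
  Fintype.ofFinite _

noncomputable instance : DecidableEq (StandardTableau k μ) := Classical.decEq _

/-- The content (column minus row) of the box that contains `i`. -/
def StandardTableau.content (t : StandardTableau k μ) (i : Fin k) : ℤ :=
  ((t.box i).1.2 : ℤ) - ((t.box i).1.1 : ℤ)

/-- The axial distance between the boxes that contain `a` and `b`. -/
def StandardTableau.axialDistance (t : StandardTableau k μ) (a b : Fin k) : ℤ :=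
  t.content b - t.content a

/-- Young's orthonormal matrix of the adjacent transposition `(a b)`, `b = a + 1`, for the shape
`μ`. -/
noncomputable def adjacentMatrix (μ : YoungDiagram) (a b : Fin k) :
    Matrix (StandardTableau k μ) (StandardTableau k μ) ℝ :=
  Matrix.of fun t s =>
    if s = t then
      if (t.box a).1.1 = (t.box b).1.1 then 1
      else if (t.box a).1.2 = (t.box b).1.2 then -1
      else (t.axialDistance a b : ℝ)⁻¹
    else if s.box = (Equiv.swap a b).trans t.box then
      √(1 - ((t.axialDistance a b : ℝ)⁻¹) ^ 2)
    else 0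

/-- Recursive construction of Young's orthonormal matrix of the transposition `(i b)`, `i < b`, from
those of the adjacent transpositions: `(i b+1) = (b b+1) (i b) (b b+1)` for `i < b`. The values for
`b ≤ i` are irrelevant. -/
noncomputable def transpositionMatrixAux (μ : YoungDiagram) (i : Fin k) :
    (b : ℕ) → b < k → Matrix (StandardTableau k μ) (StandardTableau k μ) ℝ
  | 0, _ => 1
  | b + 1, h =>
    let s := adjacentMatrix μ (⟨b, Nat.lt_of_succ_lt h⟩ : Fin k) ⟨b + 1, h⟩
    if i.1 = b then s
    else s * transpositionMatrixAux μ i b (Nat.lt_of_succ_lt h) * s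

/-- The matrix `ρ_{ij}` of the transposition `(i j)`, `i < j`, in Young's orthonormal
representation for the shape `μ`. -/
noncomputable def transpositionMatrix (μ : YoungDiagram) (i j : Fin k) :
    Matrix (StandardTableau k μ) (StandardTableau k μ) ℝ :=
  transpositionMatrixAux μ i j.1 j.2

/-- Every matrix representation that takes the prescribed values at the adjacent transpositions
takes the value `transpositionMatrix μ i j` at the transposition `(i j)`, `i < j`. -/
theorem eq_transpositionMatrix
    (ρ : Equiv.Perm (Fin k) →* Matrix (StandardTableau k μ) (StandardTableau k μ) ℝ)
    (hρ : ∀ a b : Fin k, b.1 = a.1 + 1 → ρ (Equiv.swap a b) = adjacentMatrix μ a b)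
    (i j : Fin k) (hij : i < j) :
    ρ (Equiv.swap i j) = transpositionMatrix μ i j := by
  obtain ⟨b, hb⟩ := j
  unfold transpositionMatrix
  induction b with
  | zero => exact absurd hij (by simp [Fin.lt_def])
  | succ b ih =>
    have hib : i.1 < b + 1 := hij
    simp only [transpositionMatrixAux]
    split_ifs with h
    · have hi : i = ⟨b, Nat.lt_of_succ_lt hb⟩ := Fin.ext h
      rw [hi]
      exact hρ _ _ rfl
    · have hlt : i < ⟨b, Nat.lt_of_succ_lt hb⟩ := by
        simp only [Fin.lt_def]
        omega
      have h1 : i ≠ ⟨b, Nat.lt_of_succ_lt hb⟩ := hlt.ne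
      have h2 : i ≠ ⟨b + 1, hb⟩ := hij.ne
      rw [← ih (Nat.lt_of_succ_lt hb) hlt, ← hρ ⟨b, Nat.lt_of_succ_lt hb⟩ ⟨b + 1, hb⟩ rfl,
        ← map_mul, ← map_mul]
      congr 1
      rw [Equiv.swap_mul_swap_mul_swap h1 h2, Equiv.swap_comm]

/-- The matrix `V_{ij} = I - ρ_{ij}`. -/
noncomputable def laplaceMatrix (μ : YoungDiagram) (i j : Fin k) :
    Matrix (StandardTableau k μ) (StandardTableau k μ) ℝ :=
  1 - transpositionMatrix μ i j

/-- The Jucys–Murphy matrix `X_j = ∑_{i < j} ρ_{ij}`. -/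
noncomputable def jucysMurphy (μ : YoungDiagram) (j : Fin k) :
    Matrix (StandardTableau k μ) (StandardTableau k μ) ℝ :=
  ∑ i ∈ Finset.Iio j, transpositionMatrix μ i j

/-- The matrix `(k - 1) ∑_{i < k} V_{ik} - ∑_{i < j < k} V_{ij}`, where `k = n + 1`, in Young's
orthonormal representation for the shape `μ`. -/
noncomputable def differenceMatrix (n : ℕ) (μ : YoungDiagram) :
    Matrix (StandardTableau (n + 1) μ) (StandardTableau (n + 1) μ) ℝ :=
  (n : ℝ) • ∑ i : Fin n, laplaceMatrix μ i.castSucc (Fin.last n) -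
    ∑ i : Fin n, ∑ j ∈ Finset.Ioi i, laplaceMatrix μ i.castSucc j.castSucc

end YoungForm

/-! Both parts reduce to one inequality for integers. Write `k = n + 1`. Counting shows that the
star operator times `k - 1`, minus the complete-graph operator, equals `k(k-1)/2 + ∑ X_i - k X_k`
with `X_j` the Jucys–Murphy sums (`star_sub_complete_eq`). On a joint eigenvector with eigenvalues
`a_i` it acts by `k(k-1)/2 - ∑ (a_k - a_i)`. This is nonnegative as soon as the integers `a_i` leave
no gap below `a_k`: the differences `a_k - a_i` then have sum at most `0 + 1 + ⋯ + (k-1)`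
(`nonneg_of_exists_succ`).

In part (b), `X_{j+1} = s X_j s + s` shows by induction that the `X_j` are the diagonal matrices of
contents, and the contents of a Young diagram have no gaps.

In part (a), the common weight factors out, and the claim is positivity of the same operator in the
regular representation. No decomposition into irreducibles is needed: the `X_j` commute and are
symmetric, hence jointly diagonalizable. The relations between `X_j`, `X_{j+1}` and the adjacent
transposition show that joint eigenvalues start at `0` and that each later one differs by one from
an earlier one (`IsJucysMurphyWeight.exists_adjacent`). So they are integers without gaps. -/

/-! ### Integer families without gaps -/

section Combinatorics

/-- A finite family of integers in which every positive value `w i` comes with the value `w i - 1`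
has sum at most `0 + 1 + ⋯ + (s.card - 1)`, and its values are smaller than `s.card`. -/
theorem two_mul_sum_le_of_exists_pred {ι : Type*} [DecidableEq ι] (w : ι → ℤ) (s : Finset ι)
    (h : ∀ i ∈ s, 0 < w i → ∃ j ∈ s, w j = w i - 1) :
    2 * ∑ i ∈ s, w i ≤ s.card * (s.card - 1) ∧ ∀ i ∈ s, w i ≤ s.card - 1 := by
  induction hn : s.card generalizing s with
  | zero =>
    obtain rfl := Finset.card_eq_zero.mp hn
    simp
  | succ n ih =>
    have hne : s.Nonempty := Finset.card_pos.mp (by omega)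
    obtain ⟨m, hm, hmax⟩ := s.exists_max_image w hne
    have hcard : (s.erase m).card = n := by rw [Finset.card_erase_of_mem hm]; omega
    -- A maximal value is never the predecessor of another value, so removing it preserves the
    -- hypothesis.
    obtain ⟨h1, h2⟩ := ih (s.erase m) (fun i hi hpos => by
      obtain ⟨hi1, hi2⟩ := Finset.mem_erase.mp hi
      obtain ⟨j, hj, hji⟩ := h i hi2 hpos
      refine ⟨j, Finset.mem_erase.mpr ⟨?_, hj⟩, hji⟩
      rintro rfl
      have := hmax i hi2
      omega) hcard
    -- If positive, the maximum exceeds by one a remaining value, which is at most `n - 1` by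
    -- induction.
    have hm' : w m ≤ n := by
      by_cases hpos : 0 < w m
      · obtain ⟨j, hj, hji⟩ := h m hm hpos
        have hjm : j ≠ m := by rintro rfl; omega
        have := h2 j (Finset.mem_erase.mpr ⟨hjm, hj⟩)
        omega
      · omega
    refine ⟨?_, fun i hi => ?_⟩
    · rw [← Finset.add_sum_erase s w hm]
      push_cast
      nlinarith
    · have := hmax i hi
      push_cast
      omega

/-- The inequality `k (k - 1) / 2 + ∑ a_i - k a_last ≥ 0`, `k = n + 1`, for a family of integers
that takes every value between any of its values and `a_last`. -/
theorem nonneg_of_exists_succ {n : ℕ} (a : Fin (n + 1) → ℤ)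
    (h : ∀ i, a i < a (Fin.last n) → ∃ j, a j = a i + 1) :
    (0 : ℝ) ≤ (n + 1 : ℝ) * n / 2 + ∑ i, (a i : ℝ) - (n + 1 : ℝ) * (a (Fin.last n) : ℝ) := by
  have key := (two_mul_sum_le_of_exists_pred (fun i => a (Fin.last n) - a i) Finset.univ
    (fun i _ hi => by
      obtain ⟨j, hj⟩ := h i (by omega)
      exact ⟨j, Finset.mem_univ _, by omega⟩)).1
  simp only [Finset.sum_sub_distrib, Finset.sum_const, Finset.card_univ, Fintype.card_fin,
    nsmul_eq_mul] at key
  have key' : (2 : ℝ) * ((n + 1) * (a (Fin.last n) : ℝ) - ∑ i, (a i : ℝ)) ≤ (n + 1) * n := by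
    have := (Int.cast_le (R := ℝ)).mpr key
    push_cast at this
    linarith
  linarith

/-- A family of integers with `a 0 = 0` in which every other value is adjacent to an earlier one
takes all values between `0` and any of its values. -/
theorem exists_eq_of_adjacent_earlier {n : ℕ} (a : Fin (n + 1) → ℤ) (h0 : a 0 = 0)
    (h : ∀ q, q ≠ 0 → ∃ j < q, a q = a j + 1 ∨ a q = a j - 1) (q : Fin (n + 1)) (m : ℤ)
    (hm : (0 ≤ m ∧ m ≤ a q) ∨ (a q ≤ m ∧ m ≤ 0)) : ∃ j, a j = m := by
  induction q using WellFoundedLT.induction with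
  | _ q ih =>
    by_cases hq : a q = m
    · exact ⟨q, hq⟩
    · have hq0 : q ≠ 0 := by
        rintro rfl
        omega
      obtain ⟨j, hj, hja⟩ := h q hq0
      -- A step of size one from `a q ≠ m` cannot jump over `m`, so `m` still lies between `0` and
      -- `a j`.
      exact ih j hj (by omega)

theorem exists_succ_of_adjacent_earlier {n : ℕ} (a : Fin (n + 1) → ℤ) (h0 : a 0 = 0)
    (h : ∀ q, q ≠ 0 → ∃ j < q, a q = a j + 1 ∨ a q = a j - 1) (p q : Fin (n + 1))
    (hpq : a p < a q) : ∃ j, a j = a p + 1 := by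
  by_cases hp : 0 ≤ a p
  · exact exists_eq_of_adjacent_earlier a h0 h q _ (by omega)
  · exact exists_eq_of_adjacent_earlier a h0 h p _ (by omega)

end Combinatorics

/-- The combination `(k - 1) ∑_{i < k} (1 - ρ_{ik}) - ∑_{i < j < k} (1 - ρ_{ij})`, `k = n + 1`, in
terms of the Jucys–Murphy sums `∑_{i < j} ρ_{ij}`. -/
theorem star_sub_complete_eq {A : Type*} [AddCommGroup A] [Module ℝ A] (n : ℕ) (e : A)
    (ρ : Fin (n + 1) → Fin (n + 1) → A) :
    (n : ℝ) • ∑ i : Fin n, (e - ρ i.castSucc (Fin.last n)) -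
        ∑ i : Fin n, ∑ j ∈ Finset.Ioi i, (e - ρ i.castSucc j.castSucc) =
      ((n + 1 : ℝ) * n / 2) • e + ∑ j : Fin (n + 1), ∑ i ∈ Finset.Iio j, ρ i j
        - (n + 1 : ℝ) • ∑ i ∈ Finset.Iio (Fin.last n), ρ i (Fin.last n) := by
  have h1 : ∑ i : Fin n, ∑ j ∈ Finset.Ioi i, (e - ρ i.castSucc j.castSucc) =
      ∑ j : Fin n, ∑ i ∈ Finset.Iio j, (e - ρ i.castSucc j.castSucc) :=
    Finset.sum_comm' (by simp)
  have h2 : ∑ i ∈ Finset.Iio (Fin.last n), ρ i (Fin.last n) =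
      ∑ i : Fin n, ρ i.castSucc (Fin.last n) := by
    rw [Fin.Iio_last_eq_map, Finset.sum_map]
    rfl
  have h3 : ∀ j : Fin n, ∑ i ∈ Finset.Iio j.castSucc, ρ i j.castSucc =
      ∑ i ∈ Finset.Iio j, ρ i.castSucc j.castSucc := by
    intro j
    rw [← Fin.map_castSuccEmb_Iio, Finset.sum_map]
    rfl
  have h4 : ∑ j : Fin n, ((j : ℕ) : ℝ) = n * (n - 1) / 2 := by
    rw [Fin.sum_univ_eq_sum_range (fun i => (i : ℝ)), eq_div_iff two_ne_zero]
    have := Finset.sum_range_id_mul_two n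
    rcases n with _ | n
    · simp
    · have := congrArg (Nat.cast (R := ℝ)) this
      push_cast at this ⊢
      simpa using this
  -- The coefficient of `e` is `n² - n(n-1)/2 = (n+1)n/2`. The full Jucys–Murphy sum contains the
  -- last term once, which turns the coefficient `-n` into `-(n+1)`.
  rw [h1, h2, Fin.sum_univ_castSucc (f := fun j => ∑ i ∈ Finset.Iio j, ρ i j), h2]
  simp only [h3, Finset.sum_sub_distrib, Finset.sum_const, Fin.card_Iio, Finset.card_univ,
    Fintype.card_fin, ← Nat.cast_smul_eq_nsmul ℝ]
  rw [← Finset.sum_smul, h4]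
  module

/-! ### Contents and Young's orthonormal form -/

namespace YoungForm

variable {k : ℕ} {μ : YoungDiagram}

/-- Entries increase weakly towards the lower right. -/
theorem StandardTableau.le_of_box_le (t : StandardTableau k μ) (i j : Fin k)
    (h1 : (t.box i).1.1 ≤ (t.box j).1.1) (h2 : (t.box i).1.2 ≤ (t.box j).1.2) : i ≤ j := by
  have hmem : ((t.box i).1.1, (t.box j).1.2) ∈ μ.cells :=
    μ.up_left_mem h1 le_rfl (t.box j).2
  obtain ⟨m, hm⟩ := t.box.surjective ⟨_, hmem⟩
  have e1 : (t.box m).1.1 = (t.box i).1.1 := by rw [hm]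
  have e2 : (t.box m).1.2 = (t.box j).1.2 := by rw [hm]
  have him : i ≤ m := by
    rcases h2.eq_or_lt with h | h
    · exact le_of_eq (t.box.injective (Subtype.ext (Prod.ext e1.symm (h.trans e2.symm))))
    · exact (t.row_increasing i m e1.symm (by omega)).le
  have hmj : m ≤ j := by
    rcases h1.eq_or_lt with h | h
    · exact le_of_eq (t.box.injective (Subtype.ext (Prod.ext (e1.trans h) e2)))
    · exact (t.col_increasing m j e2 (by omega)).le
  exact him.trans hmj

theorem StandardTableau.exists_box_eq (t : StandardTableau k μ) (j : Fin k) {r c : ℕ}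
    (hr : r ≤ (t.box j).1.1) (hc : c ≤ (t.box j).1.2) : ∃ m, (t.box m).1 = (r, c) := by
  obtain ⟨m, hm⟩ := t.box.surjective ⟨(r, c), μ.up_left_mem hr hc (t.box j).2⟩
  exact ⟨m, by rw [hm]⟩

/-- The box above that of `p` has content one larger. If `p` is in the top row, the next box of that
row serves: the larger content of `q` forces the diagram to reach that column. -/
theorem StandardTableau.exists_content_succ (t : StandardTableau k μ) (p q : Fin k)
    (h : t.content p < t.content q) : ∃ j, t.content j = t.content p + 1 := by
  unfold StandardTableau.content at *
  by_cases hp : (t.box p).1.1 = 0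
  · obtain ⟨m, hm⟩ := t.exists_box_eq q (r := 0) (c := (t.box p).1.2 + 1) (Nat.zero_le _)
      (by omega)
    refine ⟨m, ?_⟩
    rw [hm]
    push_cast
    omega
  · obtain ⟨m, hm⟩ := t.exists_box_eq p (r := (t.box p).1.1 - 1) (c := (t.box p).1.2)
      (by omega) le_rfl
    refine ⟨m, ?_⟩
    rw [hm]
    push_cast
    omega

theorem StandardTableau.content_zero {n : ℕ} (t : StandardTableau (n + 1) μ) :
    t.content 0 = 0 := by
  obtain ⟨m, hm⟩ := t.exists_box_eq 0 (r := 0) (c := 0) (Nat.zero_le _) (Nat.zero_le _)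
  have : m ≤ 0 := t.le_of_box_le m 0 (by rw [hm]; exact Nat.zero_le _)
    (by rw [hm]; exact Nat.zero_le _)
  obtain rfl : m = 0 := le_antisymm this (Fin.zero_le _)
  simp [StandardTableau.content, hm]

section Adjacent

variable (t : StandardTableau k μ) {a b : Fin k} (hab : b.1 = a.1 + 1)
include hab

/-- No entry lies strictly between `a` and `a + 1`. -/
theorem StandardTableau.eq_or_eq_of_box_between (m : Fin k)
    (h1 : (t.box a).1.1 ≤ (t.box m).1.1) (h2 : (t.box a).1.2 ≤ (t.box m).1.2)
    (h3 : (t.box m).1.1 ≤ (t.box b).1.1) (h4 : (t.box m).1.2 ≤ (t.box b).1.2) :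
    m = a ∨ m = b := by
  have := t.le_of_box_le a m h1 h2
  have := t.le_of_box_le m b h3 h4
  simp only [Fin.ext_iff, Fin.le_def] at *
  omega

/-- Consecutive entries are in the same row at distance one, in the same column at distance one, or
in different rows and columns, one of the boxes being strictly to the upper right of the other. -/
theorem StandardTableau.adjacent_cases :
    ((t.box a).1.1 = (t.box b).1.1 ∧ (t.box b).1.2 = (t.box a).1.2 + 1) ∨
    ((t.box a).1.2 = (t.box b).1.2 ∧ (t.box b).1.1 = (t.box a).1.1 + 1) ∨
    ((t.box a).1.1 < (t.box b).1.1 ∧ (t.box b).1.2 < (t.box a).1.2) ∨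
    ((t.box b).1.1 < (t.box a).1.1 ∧ (t.box a).1.2 < (t.box b).1.2) := by
  have hne : ¬ b ≤ a := by simp only [Fin.le_def]; omega
  have hnle : ¬ ((t.box b).1.1 ≤ (t.box a).1.1 ∧ (t.box b).1.2 ≤ (t.box a).1.2) :=
    fun h => hne (t.le_of_box_le b a h.1 h.2)
  by_cases h : (t.box a).1.1 ≤ (t.box b).1.1 ∧ (t.box a).1.2 ≤ (t.box b).1.2
  · obtain ⟨h1, h2⟩ := h
    rcases h2.eq_or_lt with h2' | h2'
    -- The box just below that of `a` lies between those of `a` and `b`, so it holds `b`; in the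
    -- other branch the same applies to the box to the right of `a`.
    · obtain ⟨m, hm⟩ := t.exists_box_eq b (r := (t.box a).1.1 + 1) (c := (t.box a).1.2)
        (by omega) h2
      rcases t.eq_or_eq_of_box_between hab m (by rw [hm]; simp) (by rw [hm])
        (by rw [hm]; dsimp only; omega) (by rw [hm]; dsimp only; omega) with rfl | rfl
      · have := congrArg Prod.fst hm
        simp at this
      · have := congrArg Prod.fst hm
        dsimp only at this
        omega
    · obtain ⟨m, hm⟩ := t.exists_box_eq b (r := (t.box a).1.1) (c := (t.box a).1.2 + 1)
        h1 (by omega)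
      rcases t.eq_or_eq_of_box_between hab m (by rw [hm]) (by rw [hm]; simp)
        (by rw [hm]; dsimp only; omega) (by rw [hm]; dsimp only; omega) with rfl | rfl
      · have := congrArg Prod.snd hm
        simp at this
      · have h5 := congrArg Prod.fst hm
        have h6 := congrArg Prod.snd hm
        dsimp only at h5 h6
        omega
  · omega

theorem StandardTableau.axialDistance_ne_zero : t.axialDistance a b ≠ 0 := by
  have := t.adjacent_cases hab
  unfold StandardTableau.axialDistance StandardTableau.content
  omega

/-- In the same row or column, consecutive entries occupy neighbouring boxes, so the axial distance
is `1` or `-1` and one formula covers all three cases. -/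
theorem adjacentMatrix_self :
    adjacentMatrix μ a b t t = (t.axialDistance a b : ℝ)⁻¹ := by
  have := t.adjacent_cases hab
  simp only [adjacentMatrix, Matrix.of_apply, if_true]
  split_ifs with h1 h2
  · have : t.axialDistance a b = 1 := by
      unfold StandardTableau.axialDistance StandardTableau.content
      omega
    simp [this]
  · have : t.axialDistance a b = -1 := by
      unfold StandardTableau.axialDistance StandardTableau.content
      omega
    simp [this, inv_neg]
  · rfl

/-- The tableau obtained by exchanging consecutive entries in different rows and columns. -/
theorem StandardTableau.exists_swap (h1 : (t.box a).1.1 ≠ (t.box b).1.1)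
    (h2 : (t.box a).1.2 ≠ (t.box b).1.2) :
    ∃ s : StandardTableau k μ, s.box = (Equiv.swap a b).trans t.box := by
  -- Since `a` and `b` are consecutive, exchanging them alters no order relation except the one
  -- between `a` and `b`.
  have key : ∀ i j : Fin k, Equiv.swap a b i < Equiv.swap a b j →
      ¬ (Equiv.swap a b i = a ∧ Equiv.swap a b j = b) → i < j := by
    intro i j hij hne
    simp only [Equiv.swap_apply_def, Fin.lt_def, Fin.ext_iff] at *
    split_ifs at * <;> omega
  refine ⟨⟨(Equiv.swap a b).trans t.box, fun i j hr hc => ?_, fun i j hc hr => ?_⟩, rfl⟩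
  · simp only [Equiv.trans_apply] at hr hc
    refine key i j (t.row_increasing _ _ hr hc) fun h => h1 ?_
    rwa [h.1, h.2] at hr
  · simp only [Equiv.trans_apply] at hr hc
    refine key i j (t.col_increasing _ _ hc hr) fun h => h2 ?_
    rwa [h.1, h.2] at hc

end Adjacent

section Swapped

variable {t s : StandardTableau k μ} {a b : Fin k}

theorem StandardTableau.box_eq_swap_symm (h : s.box = (Equiv.swap a b).trans t.box) :
    t.box = (Equiv.swap a b).trans s.box := by
  rw [h, ← Equiv.trans_assoc, ← Equiv.Perm.mul_def, Equiv.swap_mul_self]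
  rfl

theorem StandardTableau.content_of_box_eq_swap (h : s.box = (Equiv.swap a b).trans t.box)
    (i : Fin k) : s.content i = t.content (Equiv.swap a b i) := by
  simp [StandardTableau.content, h]

theorem StandardTableau.axialDistance_of_box_eq_swap
    (h : s.box = (Equiv.swap a b).trans t.box) : s.axialDistance a b = -t.axialDistance a b := by
  simp [StandardTableau.axialDistance, StandardTableau.content_of_box_eq_swap h]

theorem StandardTableau.ne_of_box_eq_swap (hab : a ≠ b)
    (h : s.box = (Equiv.swap a b).trans t.box) : s ≠ t := by
  rintro rfl
  have : s.box a = s.box b := by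
    conv_lhs => rw [h]
    simp
  exact hab (s.box.injective this)

theorem adjacentMatrix_of_box_eq_swap (hab : a ≠ b)
    (h : s.box = (Equiv.swap a b).trans t.box) :
    adjacentMatrix μ a b t s = √(1 - ((t.axialDistance a b : ℝ)⁻¹) ^ 2) := by
  simp [adjacentMatrix, StandardTableau.ne_of_box_eq_swap hab h, h]

theorem adjacentMatrix_eq_zero (hst : s ≠ t) (h : s.box ≠ (Equiv.swap a b).trans t.box) :
    adjacentMatrix μ a b t s = 0 := by
  simp [adjacentMatrix, hst, h]

end Swapped

/-- The matrix splits into blocks: `±1` when the exchange is not standard, and otherwise the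
reflection with diagonal `1/r`, `-1/r` and off-diagonal entries `√(1 - r⁻²)`. -/
theorem adjacentMatrix_mul_self {a b : Fin k} (hab : b.1 = a.1 + 1) :
    adjacentMatrix μ a b * adjacentMatrix μ a b = 1 := by
  have hne : a ≠ b := by rintro rfl; omega
  ext t u
  rw [Matrix.mul_apply]
  by_cases hsw : ∃ s : StandardTableau k μ, s.box = (Equiv.swap a b).trans t.box
  · obtain ⟨s, hs⟩ := hsw
    have hst := StandardTableau.ne_of_box_eq_swap hne hs
    have hs' := StandardTableau.box_eq_swap_symm hs
    have hr : (1 : ℝ) ≤ (t.axialDistance a b : ℝ) ^ 2 := by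
      have h0 := t.axialDistance_ne_zero hab
      have : 1 ≤ (t.axialDistance a b) ^ 2 := by
        have := sq_nonneg (t.axialDistance a b)
        have := pow_ne_zero 2 h0
        omega
      exact_mod_cast this
    have hr' : (0 : ℝ) ≤ 1 - ((t.axialDistance a b : ℝ)⁻¹) ^ 2 := by
      rw [inv_pow]
      linarith [inv_le_one_of_one_le₀ hr]
    rw [← Finset.sum_subset (Finset.subset_univ {t, s}), Finset.sum_pair hst.symm,
      adjacentMatrix_self t hab, adjacentMatrix_of_box_eq_swap hne hs]
    · by_cases hut : u = t
      · subst hut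
        rw [adjacentMatrix_self u hab, adjacentMatrix_of_box_eq_swap hne hs',
          StandardTableau.axialDistance_of_box_eq_swap hs, Matrix.one_apply_eq]
        push_cast
        rw [inv_neg, neg_sq, Real.mul_self_sqrt hr']
        ring
      · rw [Matrix.one_apply_ne (Ne.symm hut)]
        by_cases hus : u = s
        · subst hus
          rw [adjacentMatrix_self u hab, adjacentMatrix_of_box_eq_swap hne hs,
            StandardTableau.axialDistance_of_box_eq_swap hs]
          push_cast
          rw [inv_neg]
          ring
        · rw [adjacentMatrix_eq_zero hut fun h => hus (StandardTableau.ext (h.trans hs.symm)),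
            adjacentMatrix_eq_zero hus fun h => hut (StandardTableau.ext (h.trans hs'.symm))]
          simp
    · intro v _ hv
      simp only [Finset.mem_insert, Finset.mem_singleton, not_or] at hv
      rw [adjacentMatrix_eq_zero hv.1 fun h => hv.2 (StandardTableau.ext (h.trans hs.symm)),
        zero_mul]
  · have hd : t.axialDistance a b = 1 ∨ t.axialDistance a b = -1 := by
      have := t.adjacent_cases hab
      have h2 : (t.box a).1.1 = (t.box b).1.1 ∨ (t.box a).1.2 = (t.box b).1.2 := by
        by_contra! h
        exact hsw (t.exists_swap hab h.1 h.2)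
      unfold StandardTableau.axialDistance StandardTableau.content
      omega
    rw [Finset.sum_eq_single t, adjacentMatrix_self t hab]
    · by_cases hut : u = t
      · subst hut
        rw [adjacentMatrix_self u hab, Matrix.one_apply_eq]
        rcases hd with hd | hd <;> simp [hd, inv_neg]
      · rw [adjacentMatrix_eq_zero hut fun h => hsw ⟨u, h⟩, Matrix.one_apply_ne (Ne.symm hut),
          mul_zero]
    · intro v _ hv
      rw [adjacentMatrix_eq_zero hv fun h => hsw ⟨v, h⟩, zero_mul]
    · simp

/-- The relation `s X_a + 1 = X_{a+1} s` for the diagonal matrices of contents. -/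
theorem adjacentMatrix_mul_diagonal_content {a b : Fin k} (hab : b.1 = a.1 + 1) :
    adjacentMatrix μ a b * Matrix.diagonal (fun t => (t.content a : ℝ)) + 1 =
      Matrix.diagonal (fun t => (t.content b : ℝ)) * adjacentMatrix μ a b := by
  have hne : a ≠ b := by rintro rfl; omega
  ext t u
  rw [Matrix.add_apply, Matrix.mul_diagonal, Matrix.diagonal_mul]
  by_cases hut : u = t
  · subst hut
    rw [adjacentMatrix_self u hab, Matrix.one_apply_eq]
    have h0 : (u.axialDistance a b : ℝ) ≠ 0 := by exact_mod_cast u.axialDistance_ne_zero hab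
    have h1 : (u.content b : ℝ) = u.axialDistance a b + u.content a := by
      unfold StandardTableau.axialDistance
      push_cast
      ring
    rw [h1]
    field_simp
    ring
  · rw [Matrix.one_apply_ne (Ne.symm hut), add_zero]
    by_cases hs : u.box = (Equiv.swap a b).trans t.box
    · rw [StandardTableau.content_of_box_eq_swap hs, Equiv.swap_apply_left, mul_comm]
    · rw [adjacentMatrix_eq_zero hut hs]
      simp

theorem adjacentMatrix_conj_diagonal_content {a b : Fin k} (hab : b.1 = a.1 + 1) :
    adjacentMatrix μ a b * Matrix.diagonal (fun t => (t.content a : ℝ)) * adjacentMatrix μ a b +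
      adjacentMatrix μ a b = Matrix.diagonal (fun t => (t.content b : ℝ)) := by
  have h := congrArg (· * adjacentMatrix μ a b) (adjacentMatrix_mul_diagonal_content (μ := μ) hab)
  simpa only [add_mul, one_mul, mul_assoc, adjacentMatrix_mul_self hab, mul_one] using h

theorem transpositionMatrix_adjacent {a b : Fin k} (hab : b.1 = a.1 + 1) :
    transpositionMatrix μ a b = adjacentMatrix μ a b := by
  obtain ⟨b, hb⟩ := b
  obtain ⟨a, ha⟩ := a
  dsimp only at hab
  subst hab
  simp [transpositionMatrix, transpositionMatrixAux]

theorem transpositionMatrix_of_lt {i a b : Fin k} (hab : b.1 = a.1 + 1) (hi : i < a) :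
    transpositionMatrix μ i b =
      adjacentMatrix μ a b * transpositionMatrix μ i a * adjacentMatrix μ a b := by
  obtain ⟨b, hb⟩ := b
  obtain ⟨a, ha⟩ := a
  dsimp only at hab
  subst hab
  have : i.1 ≠ a := by
    simp only [Fin.lt_def] at hi
    omega
  simp [transpositionMatrix, transpositionMatrixAux, this]

theorem jucysMurphy_succ {a b : Fin k} (hab : b.1 = a.1 + 1) :
    jucysMurphy μ b =
      adjacentMatrix μ a b * jucysMurphy μ a * adjacentMatrix μ a b + adjacentMatrix μ a b := by
  have hI : Finset.Iio b = insert a (Finset.Iio a) := by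
    ext i
    simp only [Finset.mem_Iio, Finset.mem_insert, Fin.lt_def, Fin.ext_iff]
    omega
  rw [jucysMurphy, hI, Finset.sum_insert (by simp), transpositionMatrix_adjacent hab, add_comm,
    jucysMurphy, Finset.mul_sum, Finset.sum_mul]
  congr 1
  exact Finset.sum_congr rfl fun i hi => transpositionMatrix_of_lt hab (Finset.mem_Iio.mp hi)

/-- The Jucys–Murphy matrices are diagonal in Young's orthonormal form, with the contents as
entries. -/
theorem jucysMurphy_eq_diagonal {n : ℕ} (j : Fin (n + 1)) :
    jucysMurphy μ j = Matrix.diagonal (fun t => (t.content j : ℝ)) := by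
  induction j using Fin.induction with
  | zero =>
    have : Finset.Iio (0 : Fin (n + 1)) = ∅ := by ext; simp
    simp [jucysMurphy, this, StandardTableau.content_zero]
  | succ i ih =>
    have hab : i.succ.1 = i.castSucc.1 + 1 := by simp
    rw [jucysMurphy_succ hab, ih, adjacentMatrix_conj_diagonal_content hab]

theorem differenceMatrix_eq (n : ℕ) (μ : YoungDiagram) :
    differenceMatrix n μ =
      ((n + 1 : ℝ) * n / 2) •
          (1 : Matrix (StandardTableau (n + 1) μ) (StandardTableau (n + 1) μ) ℝ)
        + ∑ i : Fin (n + 1), jucysMurphy μ i - (n + 1 : ℝ) • jucysMurphy μ (Fin.last n) :=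
  star_sub_complete_eq n 1 (transpositionMatrix μ)

theorem differenceMatrix_eq_diagonal (n : ℕ) (μ : YoungDiagram) :
    differenceMatrix n μ =
      Matrix.diagonal (fun t : StandardTableau (n + 1) μ =>
        (n + 1 : ℝ) * n / 2 + ∑ i : Fin (n + 1), (t.content i : ℝ)
          - (n + 1 : ℝ) * (t.content (Fin.last n) : ℝ)) := by
  rw [differenceMatrix_eq]
  simp only [jucysMurphy_eq_diagonal]
  ext t u
  by_cases h : t = u
  · subst h
    simp [Matrix.sum_apply]
  · simp [Matrix.sum_apply, h]

end YoungForm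

/-! ### Jucys–Murphy elements in an arbitrary representation -/

section JucysMurphyElements

variable {k : ℕ} {R : Type*} [Ring R] (π : Equiv.Perm (Fin k) →* R)

/-- The image `∑_{i < j} π (i j)` of the Jucys–Murphy element. -/
def jucysMurphyElement (j : Fin k) : R :=
  ∑ i ∈ Finset.Iio j, π (Equiv.swap i j)

/-- Conjugation by `τ` sends `(i j)` to `(τ i j)` and thus only permutes the summands. -/
theorem commute_jucysMurphyElement (j : Fin k) (τ : Equiv.Perm (Fin k)) (hj : τ j = j)
    (h : ∀ i, i < j ↔ τ i < j) : Commute (π τ) (jucysMurphyElement π j) := by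
  rw [Commute, SemiconjBy, jucysMurphyElement, Finset.mul_sum, Finset.sum_mul]
  refine Finset.sum_equiv τ (by simpa using h) fun i _ => ?_
  rw [← map_mul, ← map_mul, Equiv.mul_swap_eq_swap_mul, hj]

theorem commute_swap_jucysMurphyElement {a b j : Fin k} (ha : a ≠ j) (hb : b ≠ j)
    (hab : a < j ↔ b < j) : Commute (π (Equiv.swap a b)) (jucysMurphyElement π j) := by
  refine commute_jucysMurphyElement π j _ (Equiv.swap_apply_of_ne_of_ne ha.symm hb.symm)
    fun i => ?_
  rw [Equiv.swap_apply_def]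
  split_ifs with h1 h2
  · rw [h1, hab]
  · rw [h2, hab]
  · rfl

theorem jucysMurphyElement_commute (i j : Fin k) :
    Commute (jucysMurphyElement π i) (jucysMurphyElement π j) := by
  have key : ∀ i j : Fin k, i < j →
      Commute (jucysMurphyElement π i) (jucysMurphyElement π j) := by
    intro i j hij
    rw [jucysMurphyElement.eq_def π i]
    refine Commute.sum_left _ _ _ fun l hl => ?_
    have hl' : l < j := (Finset.mem_Iio.mp hl).trans hij
    exact commute_swap_jucysMurphyElement π hl'.ne hij.ne (by simp [hl', hij])
  rcases lt_trichotomy i j with h | h | h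
  · exact key i j h
  · rw [h]
  · exact (key j i h).symm

theorem jucysMurphyElement_succ {a b : Fin k} (hab : b.1 = a.1 + 1) :
    jucysMurphyElement π b =
      π (Equiv.swap a b) * jucysMurphyElement π a * π (Equiv.swap a b) + π (Equiv.swap a b) := by
  have hI : Finset.Iio b = insert a (Finset.Iio a) := by
    ext i
    simp only [Finset.mem_Iio, Finset.mem_insert, Fin.lt_def, Fin.ext_iff]
    omega
  rw [jucysMurphyElement, hI, Finset.sum_insert (by simp), add_comm, jucysMurphyElement,
    Finset.mul_sum, Finset.sum_mul]
  congr 1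
  refine Finset.sum_congr rfl fun i hi => ?_
  have h1 : i ≠ a := (Finset.mem_Iio.mp hi).ne
  have h2 : i ≠ b := by
    have := Finset.mem_Iio.mp hi
    simp only [Fin.lt_def, ne_eq, Fin.ext_iff] at *
    omega
  rw [← map_mul, ← map_mul, Equiv.swap_mul_swap_mul_swap h1 h2, Equiv.swap_comm]

theorem map_swap_mul_self (a b : Fin k) : π (Equiv.swap a b) * π (Equiv.swap a b) = 1 := by
  rw [← map_mul, Equiv.swap_mul_self, map_one]

theorem jucysMurphyElement_mul_swap {a b : Fin k} (hab : b.1 = a.1 + 1) :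
    jucysMurphyElement π b * π (Equiv.swap a b) =
      π (Equiv.swap a b) * jucysMurphyElement π a + 1 := by
  rw [jucysMurphyElement_succ π hab, add_mul, mul_assoc _ (π (Equiv.swap a b)),
    map_swap_mul_self, mul_one]

theorem swap_mul_jucysMurphyElement {a b : Fin k} (hab : b.1 = a.1 + 1) :
    π (Equiv.swap a b) * jucysMurphyElement π b =
      jucysMurphyElement π a * π (Equiv.swap a b) + 1 := by
  rw [jucysMurphyElement_succ π hab, mul_add, ← mul_assoc, ← mul_assoc,
    map_swap_mul_self, one_mul]

end JucysMurphyElements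

/-! ### Joint eigenvalues of the Jucys–Murphy operators -/

section Weights

variable {n : ℕ} {E : Type*} [NormedAddCommGroup E] [InnerProductSpace ℝ E]
  (π : Equiv.Perm (Fin (n + 1)) →* Module.End ℝ E)

/-- `α` is the family of eigenvalues of the Jucys–Murphy operators at a joint eigenvector. -/
def IsJucysMurphyWeight (α : Fin (n + 1) → ℝ) : Prop :=
  ∃ v : E, v ≠ 0 ∧ ∀ j, jucysMurphyElement π j v = α j • v

variable {π} {α : Fin (n + 1) → ℝ}

theorem IsJucysMurphyWeight.apply_zero (h : IsJucysMurphyWeight π α) : α 0 = 0 := by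
  obtain ⟨v, hv, hα⟩ := h
  have h0 := hα 0
  have hI : Finset.Iio (0 : Fin (n + 1)) = ∅ := by ext; simp
  rw [jucysMurphyElement, hI, Finset.sum_empty, LinearMap.zero_apply] at h0
  exact (smul_eq_zero.mp h0.symm).resolve_right hv

variable {a b : Fin (n + 1)} (hab : b.1 = a.1 + 1)
include hab

/-- Pairing `s X_b v = X_a s v + v` with `v` gives `(α b - α a) ⟨v, s v⟩ = ‖v‖²`, by symmetry of
`X_a`. -/
theorem IsJucysMurphyWeight.ne_of_adjacent (hπ : ∀ i j, (π (Equiv.swap i j)).IsSymmetric)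
    (h : IsJucysMurphyWeight π α) : α a ≠ α b := by
  intro heq
  obtain ⟨v, hv, hα⟩ := h
  have h1 := LinearMap.congr_fun (swap_mul_jucysMurphyElement π hab) v
  simp only [Module.End.mul_apply, LinearMap.add_apply, Module.End.one_apply, hα, map_smul] at h1
  have hsym : (jucysMurphyElement π a).IsSymmetric :=
    LinearMap.isSymmetric_sum _ fun i _ => hπ i a
  have h2 := hsym v (π (Equiv.swap a b) v)
  have h3 := congrArg (inner ℝ v) h1
  rw [inner_add_right, ← h2, hα, heq, real_inner_smul_left, real_inner_smul_right] at h3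
  exact hv ((inner_self_eq_zero (𝕜 := ℝ)).mp (by linarith))

/-- If adjacent weights do not differ by one, exchanging them yields a weight. -/
theorem IsJucysMurphyWeight.swap (h : IsJucysMurphyWeight π α) (h1 : α b ≠ α a + 1)
    (h2 : α b ≠ α a - 1) : IsJucysMurphyWeight π (α ∘ Equiv.swap a b) := by
  obtain ⟨v, hv, hα⟩ := h
  set s := π (Equiv.swap a b) with hs
  have hss : s (s v) = v := LinearMap.congr_fun (map_swap_mul_self π a b) v
  have ha := LinearMap.congr_fun (swap_mul_jucysMurphyElement π hab) v
  have hb := LinearMap.congr_fun (jucysMurphyElement_mul_swap π hab) v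
  simp only [Module.End.mul_apply, LinearMap.add_apply, Module.End.one_apply, hα, map_smul,
    ← hs] at ha hb
  have ha' : jucysMurphyElement π a (s v) = α b • s v - v := eq_sub_of_add_eq ha.symm
  -- On the span of `v` and `s v`, this combination is the eigenvector with exchanged weights. It
  -- can vanish only if `(α b - α a)² = 1`.
  refine ⟨(α b - α a) • s v - v, fun h0 => ?_, fun j => ?_⟩
  · have e1 : (α b - α a) • s v = v := sub_eq_zero.mp h0
    have e2 : (α b - α a) • v = s v := by
      have := congrArg s e1
      rwa [map_smul, hss] at this
    rw [← e2, smul_smul] at e1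
    have e3 : (α b - α a) * (α b - α a) = 1 := by
      have : ((α b - α a) * (α b - α a) - 1) • v = 0 := by rw [sub_smul, e1, one_smul, sub_self]
      linarith [(smul_eq_zero.mp this).resolve_right hv]
    rcases mul_self_eq_one_iff.mp e3 with h | h
    · exact h1 (by linarith)
    · exact h2 (by linarith)
  · rw [map_sub, map_smul, hα, Function.comp_apply]
    by_cases hja : j = a
    · subst hja
      rw [ha', Equiv.swap_apply_left]
      module
    · by_cases hjb : j = b
      · subst hjb
        rw [hb, Equiv.swap_apply_right]
        module
      · have hc := LinearMap.congr_fun (commute_swap_jucysMurphyElement π (Ne.symm hja)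
          (Ne.symm hjb) (by simp only [Fin.lt_def, Fin.ext_iff] at *; omega)).eq v
        simp only [Module.End.mul_apply, hα, map_smul, ← hs] at hc
        rw [← hc, Equiv.swap_apply_of_ne_of_ne hja hjb]
        module

omit hab

/-- Unless `α q` already differs by one from its predecessor, exchanging the two gives a weight with
`α q` one place earlier, and induction applies. The value cannot reach place `0`: it would be `0 = α
0`, but adjacent weights differ. -/
theorem IsJucysMurphyWeight.exists_adjacent (hπ : ∀ i j, (π (Equiv.swap i j)).IsSymmetric)
    (h : IsJucysMurphyWeight π α) (q : Fin (n + 1)) (hq : q ≠ 0) :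
    ∃ j < q, α q = α j + 1 ∨ α q = α j - 1 := by
  induction hm : q.1 generalizing α q with
  | zero => exact absurd (Fin.ext hm) hq
  | succ m ih =>
    have hmn : m < n + 1 := by omega
    have hab : q.1 = (⟨m, hmn⟩ : Fin (n + 1)).1 + 1 := hm
    have hlt : (⟨m, hmn⟩ : Fin (n + 1)) < q := by simp only [Fin.lt_def]; omega
    by_cases h1 : α q = α ⟨m, hmn⟩ + 1
    · exact ⟨_, hlt, Or.inl h1⟩
    by_cases h2 : α q = α ⟨m, hmn⟩ - 1
    · exact ⟨_, hlt, Or.inr h2⟩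
    have hsw := h.swap hab h1 h2
    have hm0 : (⟨m, hmn⟩ : Fin (n + 1)) ≠ 0 := by
      intro h0
      have e1 := hsw.apply_zero
      rw [← h0, Function.comp_apply, Equiv.swap_apply_left] at e1
      have e2 := h.apply_zero
      rw [← h0] at e2
      exact h.ne_of_adjacent hab hπ (e2.trans e1.symm)
    obtain ⟨j, hj, hjα⟩ := ih hsw ⟨m, hmn⟩ hm0 rfl
    rw [Function.comp_apply, Function.comp_apply, Equiv.swap_apply_left,
      Equiv.swap_apply_of_ne_of_ne hj.ne (hj.trans hlt).ne] at hjα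
    exact ⟨j, hj.trans hlt, hjα⟩

theorem IsJucysMurphyWeight.exists_int (hπ : ∀ i j, (π (Equiv.swap i j)).IsSymmetric)
    (h : IsJucysMurphyWeight π α) (q : Fin (n + 1)) : ∃ z : ℤ, α q = z := by
  induction q using WellFoundedLT.induction with
  | _ q ih =>
    by_cases hq : q = 0
    · exact ⟨0, by rw [hq, h.apply_zero, Int.cast_zero]⟩
    · obtain ⟨j, hj, hjα⟩ := h.exists_adjacent hπ q hq
      obtain ⟨z, hz⟩ := ih j hj
      rcases hjα with e | e
      · exact ⟨z + 1, by rw [e, hz]; push_cast; rfl⟩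
      · exact ⟨z - 1, by rw [e, hz]; push_cast; rfl⟩

theorem IsJucysMurphyWeight.nonneg (hπ : ∀ i j, (π (Equiv.swap i j)).IsSymmetric)
    (h : IsJucysMurphyWeight π α) :
    0 ≤ (n + 1 : ℝ) * n / 2 + ∑ i, α i - (n + 1 : ℝ) * α (Fin.last n) := by
  choose z hz using h.exists_int hπ
  have h0 : z 0 = 0 := by
    have := h.apply_zero
    rw [hz] at this
    exact_mod_cast this
  have hadj : ∀ q, q ≠ 0 → ∃ j < q, z q = z j + 1 ∨ z q = z j - 1 := by
    intro q hq
    obtain ⟨j, hj, hjα⟩ := h.exists_adjacent hπ q hq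
    refine ⟨j, hj, ?_⟩
    rw [hz, hz] at hjα
    exact_mod_cast hjα
  simp only [hz]
  exact nonneg_of_exists_succ z fun i hi => exists_succ_of_adjacent_earlier z h0 hadj i _ hi

end Weights

/-! ### Positivity by joint diagonalization -/

section Positivity

open Module.End

/-- An operator that acts by a nonnegative scalar on every joint eigenvector of a commuting family
of symmetric operators is positive. -/
theorem inner_nonneg_of_joint_eigenvectors {ι E : Type*} [NormedAddCommGroup E]
    [InnerProductSpace ℝ E] [FiniteDimensional ℝ E] {T : ι → E →ₗ[ℝ] E}
    (hT : ∀ i, (T i).IsSymmetric) (hC : ∀ i j, Commute (T i) (T j)) (L : E →ₗ[ℝ] E)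
    (c : (ι → ℝ) → ℝ) (hL : ∀ α v, (∀ i, T i v = α i • v) → L v = c α • v)
    (hc : ∀ α v, v ≠ 0 → (∀ i, T i v = α i • v) → 0 ≤ c α) (v : E) :
    0 ≤ inner ℝ v (L v) := by
  classical
  have htop := LinearMap.IsSymmetric.iSup_iInf_eq_top_of_commute hT fun i j _ => hC i j
  have horth := LinearMap.IsSymmetric.orthogonalFamily_iInf_eigenspaces hT
  obtain ⟨f, hf, rfl⟩ := (Submodule.mem_iSup_iff_exists_finsupp _ v).mp
    (htop ▸ Submodule.mem_top : v ∈ ⨆ χ : ι → ℝ, ⨅ i, eigenspace (T i) (χ i))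
  have heig : ∀ α i, T i (f α) = α i • f α := fun α i =>
    mem_eigenspace_iff.mp ((Submodule.mem_iInf _).mp (hf α) i)
  -- Distinct joint eigenspaces are orthogonal, so only the diagonal terms `c α * ‖f α‖²` survive.
  rw [Finsupp.sum, map_sum, sum_inner]
  refine Finset.sum_nonneg fun α hα => ?_
  rw [inner_sum, Finset.sum_eq_single_of_mem α hα]
  · rw [hL α _ (heig α), real_inner_smul_right]
    exact mul_nonneg (hc α _ (Finsupp.mem_support_iff.mp hα) (heig α)) real_inner_self_nonneg
  · intro β _ hβ
    rw [hL β _ (heig β), real_inner_smul_right]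
    have : inner ℝ (f α) (f β) = 0 := horth hβ.symm ⟨f α, hf α⟩ ⟨f β, hf β⟩
    rw [this, mul_zero]

/-- In a representation in which transpositions are symmetric operators, the operator
`(k - 1) ∑_{i < k} (1 - (i k)) - ∑_{i < j < k} (1 - (i j))`, `k = n + 1`, is positive. -/
theorem inner_star_sub_complete_nonneg {n : ℕ} {E : Type*} [NormedAddCommGroup E]
    [InnerProductSpace ℝ E] [FiniteDimensional ℝ E]
    (π : Equiv.Perm (Fin (n + 1)) →* Module.End ℝ E)
    (hπ : ∀ i j, (π (Equiv.swap i j)).IsSymmetric) (v : E) :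
    0 ≤ inner ℝ v (((n : ℝ) • ∑ i : Fin n, (1 - π (Equiv.swap i.castSucc (Fin.last n))) -
      ∑ i : Fin n, ∑ j ∈ Finset.Ioi i,
        (1 - π (Equiv.swap i.castSucc j.castSucc)) : Module.End ℝ E) v) := by
  refine inner_nonneg_of_joint_eigenvectors (T := jucysMurphyElement π)
    (fun j => LinearMap.isSymmetric_sum _ fun i _ => hπ i j) (jucysMurphyElement_commute π) _
    (fun α => (n + 1 : ℝ) * n / 2 + ∑ i, α i - (n + 1 : ℝ) * α (Fin.last n))
    (fun α w hw => ?_) (fun α w hw0 hw => IsJucysMurphyWeight.nonneg hπ ⟨w, hw0, hw⟩) v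
  rw [star_sub_complete_eq n (1 : Module.End ℝ E) fun i j => π (Equiv.swap i j)]
  change (((n + 1 : ℝ) * n / 2) • (1 : Module.End ℝ E) + ∑ j, jucysMurphyElement π j -
    (n + 1 : ℝ) • jucysMurphyElement π (Fin.last n)) w = _
  simp only [LinearMap.sub_apply, LinearMap.add_apply, LinearMap.smul_apply,
    LinearMap.sum_apply, Module.End.one_apply, hw, ← Finset.sum_smul]
  module

end Positivity

/-! ### Regular representation and Dirichlet forms -/

section Regular

variable {G : Type*} [Group G] [Fintype G]

/-- The left regular representation of `G` on the Euclidean space of real functions on `G`. -/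
noncomputable def euclideanRegular (G : Type*) [Group G] [Fintype G] :
    G →* Module.End ℝ (EuclideanSpace ℝ G) where
  toFun τ :=
    { toFun := fun g => WithLp.toLp 2 fun σ => g (τ⁻¹ * σ)
      map_add' := fun _ _ => rfl
      map_smul' := fun _ _ => rfl }
  map_one' := by
    ext g σ
    simp
  map_mul' τ τ' := by
    ext g σ
    change g ((τ * τ')⁻¹ * σ) = g (τ'⁻¹ * (τ⁻¹ * σ))
    rw [mul_inv_rev, mul_assoc]

theorem euclideanRegular_apply (τ : G) (g : EuclideanSpace ℝ G) (σ : G) :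
    euclideanRegular G τ g σ = g (τ⁻¹ * σ) := rfl

theorem euclideanRegular_isSymmetric {τ : G} (hτ : τ⁻¹ = τ) :
    (euclideanRegular G τ).IsSymmetric := by
  intro g h
  simp only [PiLp.inner_apply, euclideanRegular_apply]
  rw [← Equiv.sum_comp (Equiv.mulLeft τ)]
  simp only [Equiv.coe_mulLeft, hτ, ← mul_assoc, mul_eq_one_iff_eq_inv.mpr hτ.symm, one_mul]

/-- Expanding the square gives two square sums, which agree because left translation permutes the
group; hence the factor two. -/
theorem sum_sq_sub_eq_two_mul_inner {τ : G} (hτ : τ⁻¹ = τ) (g : EuclideanSpace ℝ G) :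
    ∑ σ, (g σ - g (τ * σ)) ^ 2 = 2 * inner ℝ g ((1 - euclideanRegular G τ) g) := by
  have h1 : ∑ σ, g (τ * σ) ^ 2 = ∑ σ, g σ ^ 2 :=
    Equiv.sum_comp (Equiv.mulLeft τ) fun σ => g σ ^ 2
  have h2 : ∑ σ, (g σ - g (τ * σ)) ^ 2 =
      ∑ σ, g σ ^ 2 + ∑ σ, g (τ * σ) ^ 2 - 2 * ∑ σ, g σ * g (τ * σ) := by
    rw [Finset.mul_sum, ← Finset.sum_add_distrib, ← Finset.sum_sub_distrib]
    exact Finset.sum_congr rfl fun σ _ => by ring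
  have h3 : inner ℝ g ((1 - euclideanRegular G τ) g) =
      ∑ σ, g σ ^ 2 - ∑ σ, g σ * g (τ * σ) := by
    rw [← Finset.sum_sub_distrib, PiLp.inner_apply]
    refine Finset.sum_congr rfl fun σ _ => ?_
    rw [LinearMap.sub_apply, PiLp.sub_apply, euclideanRegular_apply, hτ, Module.End.one_apply,
      RCLike.inner_apply, conj_trivial]
    ring
  rw [h2, h1, h3]
  ring

end Regular

/-- The Dirichlet form of the complete graph on the first `n` points is at most `n` times the one of
the star that joins them to the last point. -/
theorem sum_complete_le_mul_sum_star (n : ℕ) (g : Equiv.Perm (Fin (n + 1)) → ℝ) :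
    ∑ i : Fin n, ∑ j ∈ Finset.Ioi i, ∑ σ : Equiv.Perm (Fin (n + 1)),
        (g σ - g (Equiv.swap i.castSucc j.castSucc * σ)) ^ 2 ≤
      n * ∑ i : Fin n, ∑ σ : Equiv.Perm (Fin (n + 1)),
        (g σ - g (Equiv.swap i.castSucc (Fin.last n) * σ)) ^ 2 := by
  have h := inner_star_sub_complete_nonneg (euclideanRegular (Equiv.Perm (Fin (n + 1))))
    (fun i j => euclideanRegular_isSymmetric (Equiv.swap_inv i j)) (WithLp.toLp 2 g)
  have key : ∀ i j : Fin (n + 1), ∑ σ, (g σ - g (Equiv.swap i j * σ)) ^ 2 = _ := fun i j =>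
    sum_sq_sub_eq_two_mul_inner (Equiv.swap_inv i j) (WithLp.toLp 2 g)
  simp only [key, ← Finset.mul_sum]
  simp only [LinearMap.sub_apply _ (Finset.sum _ _), LinearMap.smul_apply, LinearMap.sum_apply,
    inner_sub_right _ _ (Finset.sum _ _), real_inner_smul_right, inner_sum] at h ⊢
  linarith

theorem mainTheorem4 (n : ℕ) (hn : 2 ≤ n + 1) :
    (∀ γ : Fin n → ℝ, (∀ i, 0 ≤ γ i) → (∀ i j, γ i = γ j) →
      ∀ g : Equiv.Perm (Fin (n + 1)) → ℝ,
        ∑ σ : Equiv.Perm (Fin (n + 1)), ∑ i : Fin n, ∑ j ∈ Finset.Ioi i,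
            γ i * γ j / (∑ l, γ l) *
              (g σ - g (Equiv.swap i.castSucc j.castSucc * σ)) ^ 2
          ≤ ∑ σ : Equiv.Perm (Fin (n + 1)), ∑ i : Fin n,
              γ i * (g σ - g (Equiv.swap i.castSucc (Fin.last n) * σ)) ^ 2) ∧
    (∀ μ : YoungDiagram, μ.card = n + 1 →
      YoungForm.differenceMatrix n μ =
          ((n + 1 : ℝ) * n / 2) •
              (1 : Matrix (YoungForm.StandardTableau (n + 1) μ)
                (YoungForm.StandardTableau (n + 1) μ) ℝ)
            + ∑ i : Fin (n + 1), YoungForm.jucysMurphy μ i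
            - (n + 1 : ℝ) • YoungForm.jucysMurphy μ (Fin.last n) ∧
      YoungForm.differenceMatrix n μ =
          Matrix.diagonal (fun t : YoungForm.StandardTableau (n + 1) μ =>
            (n + 1 : ℝ) * n / 2 + ∑ i : Fin (n + 1), (t.content i : ℝ)
              - (n + 1 : ℝ) * (t.content (Fin.last n) : ℝ)) ∧
      (∀ t : YoungForm.StandardTableau (n + 1) μ,
        0 ≤ (n + 1 : ℝ) * n / 2 + ∑ i : Fin (n + 1), (t.content i : ℝ)
              - (n + 1 : ℝ) * (t.content (Fin.last n) : ℝ)) ∧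
      (YoungForm.differenceMatrix n μ).PosSemidef) := by
  refine ⟨fun γ hγ heq g => ?_, fun μ _ => ?_⟩
  · have hn0 : 0 < n := by omega
    obtain ⟨c, rfl⟩ : ∃ c, γ = fun _ => c := ⟨γ ⟨0, hn0⟩, funext fun i => heq i _⟩
    have hc : 0 ≤ c := hγ ⟨0, hn0⟩
    have hn1 : (0 : ℝ) < n := by exact_mod_cast hn0
    -- For `c = 0` division by zero yields `0`, matching the stated convention.
    have hcoef : c * c / ∑ _l : Fin n, c = c / n := by
      rcases eq_or_ne c 0 with rfl | hc0
      · simp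
      · rw [Finset.sum_const, Finset.card_univ, Fintype.card_fin, nsmul_eq_mul]
        field_simp
    simp only [hcoef, ← Finset.mul_sum]
    rw [Finset.sum_comm, Finset.sum_comm (s := Finset.univ (α := Equiv.Perm (Fin (n + 1))))]
    simp only [Finset.sum_comm (s := Finset.univ (α := Equiv.Perm (Fin (n + 1))))
      (t := Finset.Ioi _)]
    calc _ ≤ c / n * (n * ∑ i : Fin n, ∑ σ : Equiv.Perm (Fin (n + 1)),
          (g σ - g (Equiv.swap i.castSucc (Fin.last n) * σ)) ^ 2) :=
        mul_le_mul_of_nonneg_left (sum_complete_le_mul_sum_star n g) (div_nonneg hc hn1.le)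
      _ = _ := by
        rw [← mul_assoc, div_mul_cancel₀ _ hn1.ne']
  · have hnonneg := fun t : YoungForm.StandardTableau (n + 1) μ =>
      nonneg_of_exists_succ t.content fun i hi => t.exists_content_succ i _ hi
    refine ⟨YoungForm.differenceMatrix_eq n μ, YoungForm.differenceMatrix_eq_diagonal n μ,
      hnonneg, ?_⟩
    rw [YoungForm.differenceMatrix_eq_diagonal]
    exact Matrix.PosSemidef.diagonal hnonneg
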